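/- Let $N\ge 1$ be an integer and let $s\in(0,1)$. Consider the equation $$\Delta u-(-\Delta)^s u-\rho\,c\,u=0\quad\text{in }\mathbb R^N,\qquad (1)$$ where $$(-\Delta)^s u(x)=C_{N,s}\lim_{\varepsilon\to0^+}\int_{\{|x-y|\ge\varepsilon\}}\frac{u(x)-u(y)}{|x-y|^{N+2s}}\,dy,\qquad C_{N,s}=\frac{2^{2s-1}\,2s\,\Gamma\big(\frac{N+2s}{2}\big)}{\pi^{N/2}\,\Gamma(1-s)} .$$ A classical solution of (1) is a function $u\in C^2(\mathbb R^N)$ with $\int_{\mathbb R^N}\frac{|u(x)|}{1+|x|^{N+2s}}\,dx<\infty$ such that, at every $x\in\mathbb R^N$, the limit defining $(-\Delta)^s u(x)$ exists and is finite, and (1) holds. For all $\alpha$ and $C_0$ with $0\le\alpha<2s$ and $C_0>0$ there is a constant $K$, depending only on $N,s,\alpha,C_0$, such that the following holds. Let $p\ge1$ and $c_0>0$ be real numbers with $p\,c_0\ge K$. Let $\rho,c:\mathbb R^N\to\mathbb R$ be continuous with $$\rho(x)\ge C_0(1+|x|^2)^{-\alpha/2},\qquad c(x)\ge c_0\qquad\text{for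 all }x\in\mathbb R^N .$$ If $u$ is a classical solution of (1) and, for some $C>0$ and some $\theta$ with $0\le\theta<2s-\alpha$, $$|u(x)|\le C(1+|x|^2)^{\theta/2}\qquad\text{for all }x\in\mathbb R^N,$$ then $u(x)=0$ for all $x\in\mathbb R^N$. -/

import Mathlib

open Set Filter Topology MeasureTheory

noncomputable section

namespace MixedElliptic

/-- Euclidean space of dimension `N`, with the Euclidean norm and Lebesgue measure. -/
abbrev Eucl (N : ℕ) : Type := EuclideanSpace ℝ (Fin N)

/-- The normalization constant `C_{N,s}` of the fractional Laplacian. -/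
def fracConst (N : ℕ) (s : ℝ) : ℝ :=
  2 ^ (2 * s - 1) * (2 * s) * Real.Gamma (((N : ℝ) + 2 * s) / 2) /
    (Real.pi ^ ((N : ℝ) / 2) * Real.Gamma (1 - s))

/-- The truncated singular integral
`C_{N,s} ∫_{|x-y| ≥ ε} (u(x) - u(y)) / |x-y|^{N+2s} dy`. -/
def truncFracLaplacian {N : ℕ} (s : ℝ) (u : Eucl N → ℝ) (x : Eucl N) (ε : ℝ) : ℝ :=
  fracConst N s *
    ∫ y in {y : Eucl N | ε ≤ ‖x - y‖}, (u x - u y) / ‖x - y‖ ^ ((N : ℝ) + 2 * s)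

/-- `(-Δ)^s u (x)` exists (as a principal value, finite) and equals `l`. -/
def HasFracLaplacianAt {N : ℕ} (s : ℝ) (u : Eucl N → ℝ) (l : ℝ) (x : Eucl N) : Prop :=
  Tendsto (fun ε : ℝ => truncFracLaplacian s u x ε) (𝓝[>] 0) (𝓝 l)

/-- The space of (measurable) functions `f` with `∫ |f(x)| / (1 + |x|^{N+2s}) dx < ∞`. -/
def MemLs {N : ℕ} (s : ℝ) (f : Eucl N → ℝ) : Prop :=
  Integrable (fun x : Eucl N => f x / (1 + ‖x‖ ^ ((N : ℝ) + 2 * s)))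

/-- Hypothesis on `ρ`: it is continuous and `ρ(x) ≥ C₀ (1 + |x|²)^{-α/2}`,
with `α ≥ 0` and `C₀ > 0`. -/
structure HypRho {N : ℕ} (α C₀ : ℝ) (ρ : Eucl N → ℝ) : Prop where
  continuous : Continuous ρ
  alpha_nonneg : 0 ≤ α
  const_pos : 0 < C₀
  lower_bound : ∀ x, C₀ * (1 + ‖x‖ ^ 2) ^ (-α / 2) ≤ ρ x

/-- Hypothesis on `c`: it is continuous and nonnegative. -/
structure HypC {N : ℕ} (c : Eucl N → ℝ) : Prop where
  continuous : Continuous c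
  nonneg : ∀ x, 0 ≤ c x

/-- Classical solution of `Δu - (-Δ)^s u - ρ c u = 0` in the whole space. -/
structure IsClassicalSolution {N : ℕ} (s : ℝ) (ρ c u : Eucl N → ℝ) : Prop where
  contDiff : ContDiff ℝ 2 u
  memLs : MemLs s u
  equation : ∀ x, ∃ l : ℝ, HasFracLaplacianAt s u l x ∧
    Laplacian.laplacian u x - l - ρ x * c x * u x = 0

end MixedElliptic

end

namespace MixedElliptic

/-! The proof compares `u` with a barrier. Fix `β` with `θ < β < 2s - α` and put `X = 1 + ‖x‖²`. If
`u - ε (X ^ (β / 2) + b)` is positive somewhere, it attains a positive global maximum at some `x`,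
because `β > θ`. There `u` is touched from above by a translate of the barrier, so `Δu ≤ ε N β X ^
(β / 2 - 1)` (`laplacian_le_of_touching`) and `(-Δ)^s u ≥ -ε A X ^ (β / 2 - s)`
(`neg_le_truncFracLaplacian`). Both powers are at most `X ^ (-α / 2)`, so the equation gives `ρ c u
≤ ε (N β + A) X ^ (-α / 2)`. But `u x > ε b` and `ρ c ≥ C₀ c₀ X ^ (-α / 2)`, which is contradictory
for `b = (N β + A) / (C₀ c₀)`. Letting `ε → 0` gives `u ≤ 0`; the equation is linear, so the same
holds for `-u`. -/

/-! ### Second-order conditions at a touching point. -/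

/-- Second-order necessary condition for a local maximum. -/
theorem deriv_deriv_nonpos_of_isLocalMax {h : ℝ → ℝ} {t : ℝ} (hmax : IsLocalMax h t)
    (hc : ContinuousAt h t) : deriv (deriv h) t ≤ 0 := by
  by_contra! hpos
  have hmin := isLocalMin_of_deriv_deriv_pos hpos hmax.deriv_eq_zero hc
  -- A local maximum that is also a local minimum makes `h` locally constant, so its second
  -- derivative vanishes.
  have hconst : h =ᶠ[𝓝 t] fun _ => h t := by
    filter_upwards [hmax, hmin] with y h₁ h₂ using le_antisymm h₁ h₂
  have := hconst.deriv.deriv_eq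
  simp at this
  linarith

/-- A function of class `C²` touched from above at `x` by a quadratic polynomial with leading
part `a ‖y‖²` has second derivative at most `2 a` in each unit direction. -/
theorem iteratedFDeriv_two_le_of_touching {N : ℕ} {u : Eucl N → ℝ} (hu : ContDiff ℝ 2 u)
    {x : Eucl N} {a : ℝ} (htouch : ∀ z, u (x + z) - u x ≤ a * (2 * inner ℝ x z + ‖z‖ ^ 2))
    {e : Eucl N} (he : ‖e‖ = 1) : iteratedFDeriv ℝ 2 u x ![e, e] ≤ 2 * a := by
  set b : ℝ := 2 * a * inner ℝ x e
  have hline : ∀ t : ℝ, HasDerivAt (fun t : ℝ => x + t • e) e t := fun t => by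
    simpa using ((hasDerivAt_id t).smul_const e).const_add x
  have hd1 : ∀ t : ℝ, HasDerivAt (fun t : ℝ => u (x + t • e) - (b * t + a * t ^ 2))
      (fderiv ℝ u (x + t • e) e - (b + 2 * a * t)) t := fun t => by
    have h1 := ((hu.differentiable (by norm_num)) (x + t • e)).hasFDerivAt.comp_hasDerivAt t
      (hline t)
    have h2 : HasDerivAt (fun t : ℝ => b * t + a * t ^ 2) (b + 2 * a * t) t := by
      have := ((hasDerivAt_id t).const_mul b).add ((hasDerivAt_pow 2 t).const_mul a)
      refine this.congr_deriv ?_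
      simp; ring
    exact h1.sub h2
  have hd2 : HasDerivAt (fun t : ℝ => fderiv ℝ u (x + t • e) e - (b + 2 * a * t))
      (fderiv ℝ (fderiv ℝ u) x e e - 2 * a) 0 := by
    have hdf : Differentiable ℝ (fderiv ℝ u) :=
      (hu.fderiv_right (m := 1) (by norm_num)).differentiable (by norm_num)
    have h1 := (hdf (x + (0 : ℝ) • e)).hasFDerivAt.comp_hasDerivAt (0 : ℝ) (hline 0)
    have h1' := h1.clm_apply (hasDerivAt_const (0 : ℝ) e)
    have h2 : HasDerivAt (fun t : ℝ => b + 2 * a * t) (2 * a) 0 := by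
      simpa using ((hasDerivAt_id (0 : ℝ)).const_mul (2 * a)).const_add b
    refine (h1'.sub h2).congr_deriv ?_
    simp
  have hmax : IsLocalMax (fun t : ℝ => u (x + t • e) - (b * t + a * t ^ 2)) 0 := by
    refine Eventually.of_forall fun t => ?_
    have := htouch (t • e)
    rw [inner_smul_right, norm_smul, he, mul_one, Real.norm_eq_abs, sq_abs] at this
    simp only [zero_smul, add_zero, mul_zero, ne_eq, OfNat.ofNat_ne_zero, not_false_eq_true,
      zero_pow, sub_zero, b]
    linarith
  have hle := deriv_deriv_nonpos_of_isLocalMax hmax (hd1 0).continuousAt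
  have hderiv : deriv (fun t : ℝ => u (x + t • e) - (b * t + a * t ^ 2)) =
      fun t : ℝ => fderiv ℝ u (x + t • e) e - (b + 2 * a * t) := funext fun t => (hd1 t).deriv
  rw [hderiv, hd2.deriv] at hle
  rw [iteratedFDeriv_two_apply]
  simpa using hle

theorem laplacian_le_of_touching {N : ℕ} {u : Eucl N → ℝ} (hu : ContDiff ℝ 2 u)
    {x : Eucl N} {a : ℝ} (htouch : ∀ z, u (x + z) - u x ≤ a * (2 * inner ℝ x z + ‖z‖ ^ 2)) :
    Laplacian.laplacian u x ≤ 2 * N * a := by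
  rw [congrFun (InnerProductSpace.laplacian_eq_iteratedFDeriv_orthonormalBasis u
    (EuclideanSpace.basisFun (Fin N) ℝ)) x]
  refine (Finset.sum_le_card_nsmul _ _ (2 * a) fun i _ =>
    iteratedFDeriv_two_le_of_touching hu htouch (OrthonormalBasis.norm_eq_one _ i)).trans_eq ?_
  simp; ring

/-! ### Concavity and the dominating kernel. -/

/-- Concavity of `t ↦ t ^ γ`, in tangent line form. -/
theorem rpow_sub_rpow_le_mul_sub {γ A B : ℝ} (h0 : 0 ≤ γ) (h1 : γ ≤ 1) (hA : 0 < A)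
    (hB : 0 ≤ B) : B ^ γ - A ^ γ ≤ γ * A ^ (γ - 1) * (B - A) := by
  have hb := rpow_one_add_le_one_add_mul_self (s := B / A - 1)
    (by linarith [div_nonneg hB hA.le]) h0 h1
  have hA' := Real.rpow_pos_of_pos hA γ
  rw [add_sub_cancel, Real.div_rpow hB hA.le, div_le_iff₀ hA'] at hb
  rw [Real.rpow_sub_one hA.ne']
  have : γ * (A ^ γ / A) * (B - A) = γ * (B / A - 1) * A ^ γ := by field_simp
  linarith

/-- The profile of the integrable kernel that dominates the symmetrised second differences of
`(1 + ‖x‖²) ^ (β / 2)`. -/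
noncomputable def levyProfile (N : ℕ) (s β t : ℝ) : ℝ :=
  min (t ^ 2) (t ^ β) / t ^ ((N : ℝ) + 2 * s)

theorem levyProfile_nonneg {N : ℕ} {s β t : ℝ} (ht : 0 ≤ t) : 0 ≤ levyProfile N s β t := by
  unfold levyProfile; positivity

theorem integrable_levyProfile_norm {N : ℕ} (hN : 1 ≤ N) {s β : ℝ} (hs1 : s < 1)
    (hβ : β < 2 * s) : Integrable fun z : Eucl N => levyProfile N s β ‖z‖ := by
  have : Nonempty (Fin N) := ⟨⟨0, hN⟩⟩
  have hmeas : Measurable (levyProfile N s β) := by unfold levyProfile; fun_prop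
  rw [integrable_fun_norm_addHaar volume (f := levyProfile N s β)]
  simp only [finrank_euclideanSpace, Fintype.card_fin, smul_eq_mul]
  have hm : AEStronglyMeasurable (fun t : ℝ => t ^ (N - 1) * levyProfile N s β t) :=
    (by fun_prop : Measurable _).aestronglyMeasurable
  have key : ∀ {t : ℝ} (p : ℝ), 0 < t →
      t ^ (N - 1) * (t ^ p / t ^ ((N : ℝ) + 2 * s)) = t ^ (p - 1 - 2 * s) := fun p ht => by
    rw [← Real.rpow_natCast, ← Real.rpow_sub ht, ← Real.rpow_add ht, Nat.cast_sub hN]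
    congr 1; push_cast; ring
  rw [← Ioc_union_Ioi_eq_Ioi zero_le_one]
  refine IntegrableOn.union ?_ ?_
  -- Integrability at the origin uses `s < 1`; at infinity it uses `β < 2 s`.
  · have hi : IntegrableOn (fun t : ℝ => t ^ ((2 : ℝ) - 1 - 2 * s)) (Ioc 0 1) :=
      (intervalIntegrable_iff_integrableOn_Ioc_of_le zero_le_one).1
        (intervalIntegral.intervalIntegrable_rpow' (by linarith))
    refine hi.mono' hm.restrict ((ae_restrict_iff' measurableSet_Ioc).2 (ae_of_all _ ?_))
    intro t ht
    have ht0 : 0 < t := ht.1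
    rw [Real.norm_of_nonneg (mul_nonneg (by positivity) (levyProfile_nonneg ht0.le)), ← key _ ht0,
      levyProfile, Real.rpow_two]
    gcongr
    exact min_le_left _ _
  · have hi : IntegrableOn (fun t : ℝ => t ^ (β - 1 - 2 * s)) (Ioi 1) :=
      integrableOn_Ioi_rpow_of_lt (by linarith) one_pos
    refine hi.mono' hm.restrict ((ae_restrict_iff' measurableSet_Ioi).2 (ae_of_all _ ?_))
    intro t (ht : 1 < t)
    have ht0 : 0 < t := one_pos.trans ht
    rw [Real.norm_of_nonneg (mul_nonneg (by positivity) (levyProfile_nonneg ht0.le)), ← key _ ht0,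
      levyProfile]
    gcongr
    exact min_le_right _ _

/-- The Jacobian `r ^ N` leaves `r ^ (-2s)`; with `r = √(1 + ‖x‖²)` this is the decay gained by the
fractional Laplacian of the barrier. -/
theorem integral_levyProfile_scaled {N : ℕ} {s β r : ℝ} (hr : 0 < r) :
    ∫ z : Eucl N, r ^ (-((N : ℝ) + 2 * s)) * levyProfile N s β ‖r⁻¹ • z‖ =
      r ^ (-(2 * s)) * ∫ z : Eucl N, levyProfile N s β ‖z‖ := by
  rw [integral_const_mul, Measure.integral_comp_inv_smul_of_nonneg volume
    (fun z : Eucl N => levyProfile N s β ‖z‖) hr.le, smul_eq_mul, ← mul_assoc]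
  congr 1
  rw [finrank_euclideanSpace, Fintype.card_fin, ← Real.rpow_natCast, ← Real.rpow_add hr]
  congr 1; ring

theorem levyProfile_scaled {N : ℕ} {s β r : ℝ} (hr : 0 < r) (z : Eucl N) :
    r ^ (-((N : ℝ) + 2 * s)) * levyProfile N s β ‖r⁻¹ • z‖ =
      min ((‖z‖ / r) ^ 2) ((‖z‖ / r) ^ β) / ‖z‖ ^ ((N : ℝ) + 2 * s) := by
  have hn : ‖r⁻¹ • z‖ = ‖z‖ / r := by
    rw [norm_smul, Real.norm_of_nonneg (inv_nonneg.2 hr.le), div_eq_inv_mul]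
  rw [hn, levyProfile, Real.div_rpow (norm_nonneg z) hr.le ((N : ℝ) + 2 * s), Real.rpow_neg hr.le]
  have := Real.rpow_pos_of_pos hr ((N : ℝ) + 2 * s)
  field_simp

/-! ### Differences of the barrier. -/

theorem one_add_norm_add_sq_sub {N : ℕ} (x z : Eucl N) :
    1 + ‖x + z‖ ^ 2 - (1 + ‖x‖ ^ 2) = 2 * inner ℝ x z + ‖z‖ ^ 2 := by
  rw [norm_add_sq_real]; ring

theorem bracket_sub_le {N : ℕ} {β : ℝ} (h0 : 0 ≤ β) (h2 : β ≤ 2) (x z : Eucl N) :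
    (1 + ‖x + z‖ ^ 2) ^ (β / 2) - (1 + ‖x‖ ^ 2) ^ (β / 2) ≤
      β / 2 * (1 + ‖x‖ ^ 2) ^ (β / 2 - 1) * (2 * inner ℝ x z + ‖z‖ ^ 2) := by
  rw [← one_add_norm_add_sq_sub]
  exact rpow_sub_rpow_le_mul_sub (by linarith) (by linarith) (by positivity) (by positivity)

/-- Symmetrised second difference of `(1 + ‖x‖²) ^ (β / 2)`. -/
theorem bracket_second_difference_le {N : ℕ} {β : ℝ} (h0 : 0 ≤ β) (h2 : β ≤ 2) (x z : Eucl N) :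
    (1 + ‖x + z‖ ^ 2) ^ (β / 2) + (1 + ‖x - z‖ ^ 2) ^ (β / 2) - 2 * (1 + ‖x‖ ^ 2) ^ (β / 2) ≤
      8 * (1 + ‖x‖ ^ 2) ^ (β / 2) * min ((‖z‖ / √(1 + ‖x‖ ^ 2)) ^ 2)
        ((‖z‖ / √(1 + ‖x‖ ^ 2)) ^ β) := by
  set X : ℝ := 1 + ‖x‖ ^ 2 with hX
  have hX0 : 0 < X := by positivity
  have hr : 0 < √X := Real.sqrt_pos.2 hX0
  have hr2 : √X ^ 2 = X := Real.sq_sqrt hX0.le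
  have hXβ : X ^ (β / 2) = √X ^ β := by
    rw [Real.sqrt_eq_rpow, ← Real.rpow_mul hX0.le]; congr 1; ring
  rcases le_total (‖z‖ / √X) 1 with hz | hz
  · have hmin : min ((‖z‖ / √X) ^ 2) ((‖z‖ / √X) ^ β) = (‖z‖ / √X) ^ 2 := by
      refine min_eq_left ?_
      rcases (show 0 ≤ ‖z‖ / √X by positivity).eq_or_lt with h | h
      · rw [← h]; simpa using Real.rpow_nonneg le_rfl β
      · rw [← Real.rpow_two]; exact Real.rpow_le_rpow_of_exponent_ge h hz h2
    -- Near regime: in the sum of the two tangent bounds the terms linear in `z` cancel.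
    have e1 := bracket_sub_le h0 h2 x z
    have e2 := bracket_sub_le h0 h2 x (-z)
    rw [inner_neg_right, norm_neg, ← sub_eq_add_neg] at e2
    rw [hmin, div_pow, hr2]
    rw [← hX, Real.rpow_sub_one hX0.ne'] at e1 e2
    have : 8 * X ^ (β / 2) * (‖z‖ ^ 2 / X) -
        β * (X ^ (β / 2) / X) * ‖z‖ ^ 2 = (8 - β) * (X ^ (β / 2) * ‖z‖ ^ 2 / X) := by ring
    have h' : 0 ≤ (8 - β) * (X ^ (β / 2) * ‖z‖ ^ 2 / X) :=
      mul_nonneg (by linarith) (by positivity)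
    linarith
  · have hmin : min ((‖z‖ / √X) ^ 2) ((‖z‖ / √X) ^ β) = (‖z‖ / √X) ^ β := by
      refine min_eq_right ?_
      rw [← Real.rpow_two]; exact Real.rpow_le_rpow_of_exponent_le hz h2
    have hzr : √X ≤ ‖z‖ := by rwa [one_le_div hr] at hz
    have hz2 : X ≤ ‖z‖ ^ 2 := by rw [← hr2]; gcongr
    have hxz : ‖x‖ ≤ ‖z‖ := by
      refine (sq_le_sq₀ (norm_nonneg x) (norm_nonneg z)).1 ?_
      linarith
    -- Far regime: each translate is bounded separately, and the two bounds add up to the constant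
    -- 8.
    have hfar : ∀ y : Eucl N, ‖y‖ ≤ ‖x‖ + ‖z‖ → (1 + ‖y‖ ^ 2) ^ (β / 2) ≤ 4 * ‖z‖ ^ β := by
      intro y hy
      have hy2 : 1 + ‖y‖ ^ 2 ≤ 4 * ‖z‖ ^ 2 := by
        have : ‖y‖ ^ 2 ≤ (‖x‖ + ‖z‖) ^ 2 := by gcongr
        nlinarith [norm_nonneg x, norm_nonneg z]
      calc (1 + ‖y‖ ^ 2) ^ (β / 2) ≤ (4 * ‖z‖ ^ 2) ^ (β / 2) := by gcongr
        _ = 4 ^ (β / 2) * ‖z‖ ^ β := by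
          rw [Real.mul_rpow (by norm_num) (by positivity), ← Real.rpow_natCast,
            ← Real.rpow_mul (norm_nonneg z)]
          congr 2; push_cast; ring
        _ ≤ 4 * ‖z‖ ^ β := by
          gcongr
          conv_rhs => rw [← Real.rpow_one 4]
          exact Real.rpow_le_rpow_of_exponent_le (by norm_num) (by linarith)
    rw [hmin, hXβ, Real.div_rpow (norm_nonneg z) hr.le]
    have e1 := hfar _ (norm_add_le x z)
    have e2 := hfar _ (norm_sub_le x z)
    have h3 := Real.rpow_pos_of_pos hr β
    have : 8 * √X ^ β * (‖z‖ ^ β / √X ^ β) = 8 * ‖z‖ ^ β := by field_simp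
    linarith

/-! ### Truncated fractional Laplacians. -/

theorem truncFracLaplacian_eq {N : ℕ} (s : ℝ) (u : Eucl N → ℝ) (x : Eucl N) (δ : ℝ) :
    truncFracLaplacian s u x δ = fracConst N s * ∫ z, {z : Eucl N | δ ≤ ‖z‖}.indicator
      (fun z => (u x - u (x - z)) / ‖z‖ ^ ((N : ℝ) + 2 * s)) z := by
  rw [truncFracLaplacian, ← integral_indicator (measurableSet_le (by fun_prop) (by fun_prop)),
    ← integral_sub_left_eq_self _ volume x]
  congr 2 with z
  simp [indicator]

theorem fracConst_nonneg (N : ℕ) {s : ℝ} (hs0 : 0 < s) (hs1 : s < 1) : 0 ≤ fracConst N s := by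
  have h1 := Real.Gamma_pos_of_pos (s := ((N : ℝ) + 2 * s) / 2) (by positivity)
  have h2 := Real.Gamma_pos_of_pos (s := 1 - s) (by linarith)
  unfold fracConst; positivity

theorem one_add_norm_sub_sq_le {N : ℕ} {x z : Eucl N} {δ : ℝ} (hδ : 0 < δ) (hz : δ ≤ ‖z‖) :
    1 + ‖x - z‖ ^ 2 ≤ ((1 + 2 * ‖x‖ ^ 2) / δ ^ 2 + 2) * ‖z‖ ^ 2 := by
  have h1 : ‖x - z‖ ^ 2 ≤ (‖x‖ + ‖z‖) ^ 2 := by gcongr; exact norm_sub_le x z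
  have h2 : 1 + 2 * ‖x‖ ^ 2 ≤ (1 + 2 * ‖x‖ ^ 2) / δ ^ 2 * ‖z‖ ^ 2 := by
    rw [div_mul_eq_mul_div, le_div_iff₀ (by positivity)]; gcongr
  nlinarith [sq_nonneg (‖x‖ - ‖z‖)]

/-- For continuous functions of growth less than `2 s` the truncated integral converges. -/
theorem integrable_truncated_difference {N : ℕ} (hN : 1 ≤ N) {s β C δ : ℝ} (hs1 : s < 1)
    (hβ0 : 0 ≤ β) (hβ : β < 2 * s) (hC : 0 ≤ C) (hδ : 0 < δ) {u : Eucl N → ℝ} (hu : Continuous u)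
    (hgrowth : ∀ x, |u x| ≤ C * (1 + ‖x‖ ^ 2) ^ (β / 2)) (x : Eucl N) :
    Integrable ({z : Eucl N | δ ≤ ‖z‖}.indicator
      (fun z => (u x - u (x - z)) / ‖z‖ ^ ((N : ℝ) + 2 * s))) := by
  have hS : MeasurableSet {z : Eucl N | δ ≤ ‖z‖} := measurableSet_le (by fun_prop) (by fun_prop)
  set κ : ℝ := ((1 + 2 * ‖x‖ ^ 2) / δ ^ 2 + 2) ^ (β / 2) with hκ
  -- Chosen so that `m * ‖z‖ ^ β` lies below the numerator of the profile when `‖z‖ ≥ δ`.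
  set m : ℝ := min 1 (δ ^ (2 - β)) with hm
  have hm0 : 0 < m := lt_min one_pos (Real.rpow_pos_of_pos hδ _)
  set D : ℝ := (|u x| * δ ^ (-β) + C * κ) / m with hD
  have hmeas : Measurable (fun z : Eucl N => (u x - u (x - z)) / ‖z‖ ^ ((N : ℝ) + 2 * s)) := by
    have := hu.measurable
    fun_prop
  refine ((integrable_levyProfile_norm hN hs1 hβ).const_mul D).mono'
    (hmeas.indicator hS).aestronglyMeasurable (ae_of_all _ fun z => ?_)
  have hnn := levyProfile_nonneg (N := N) (s := s) (β := β) (norm_nonneg z)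
  by_cases hz : δ ≤ ‖z‖
  swap
  · rw [indicator_of_notMem (by exact hz), norm_zero]; positivity
  have hz0 : 0 < ‖z‖ := hδ.trans_le hz
  have hzβ := Real.rpow_pos_of_pos hz0 β
  have hu1 : |u x| ≤ |u x| * δ ^ (-β) * ‖z‖ ^ β := by
    rw [mul_assoc]
    refine le_mul_of_one_le_right (abs_nonneg _) ?_
    rw [Real.rpow_neg hδ.le, ← div_eq_inv_mul, one_le_div (Real.rpow_pos_of_pos hδ _)]
    gcongr
  have hu2 : |u (x - z)| ≤ C * κ * ‖z‖ ^ β := by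
    refine (hgrowth _).trans ?_
    rw [mul_assoc]
    gcongr
    calc (1 + ‖x - z‖ ^ 2) ^ (β / 2)
        ≤ (((1 + 2 * ‖x‖ ^ 2) / δ ^ 2 + 2) * ‖z‖ ^ 2) ^ (β / 2) := by
          gcongr; exact one_add_norm_sub_sq_le hδ hz
      _ = κ * ‖z‖ ^ β := by
          rw [Real.mul_rpow (by positivity) (by positivity), ← Real.rpow_natCast ‖z‖,
            ← Real.rpow_mul (norm_nonneg z)]
          congr 2; push_cast; ring
  have hmin : m * ‖z‖ ^ β ≤ min (‖z‖ ^ 2) (‖z‖ ^ β) := by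
    refine le_min ?_ ?_
    · calc m * ‖z‖ ^ β ≤ ‖z‖ ^ (2 - β) * ‖z‖ ^ β := by
            gcongr
            exact (min_le_right _ _).trans
              (Real.rpow_le_rpow hδ.le hz (by linarith))
        _ = ‖z‖ ^ 2 := by rw [← Real.rpow_add hz0, sub_add_cancel, Real.rpow_two]
    · exact mul_le_of_le_one_left hzβ.le (min_le_left _ _)
  rw [indicator_of_mem (by exact hz), norm_div, Real.norm_eq_abs,
    Real.norm_of_nonneg (Real.rpow_nonneg hz0.le _), levyProfile, ← mul_div_assoc]
  gcongr
  calc |u x - u (x - z)| ≤ |u x| + |u (x - z)| := abs_sub _ _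
    _ ≤ (|u x| * δ ^ (-β) + C * κ) * ‖z‖ ^ β := by linarith
    _ = D * (m * ‖z‖ ^ β) := by rw [hD]; field_simp
    _ ≤ D * min (‖z‖ ^ 2) (‖z‖ ^ β) := by gcongr

/-- A function touched from above by a multiple of `(1 + ‖x‖²) ^ (β / 2)` has truncated fractional
Laplacians bounded below, uniformly in the truncation. -/
theorem neg_le_truncFracLaplacian {N : ℕ} (hN : 1 ≤ N) {s β C δ a : ℝ} (hs0 : 0 < s)
    (hs1 : s < 1) (hβ0 : 0 ≤ β) (hβ : β < 2 * s) (hC : 0 ≤ C) (hδ : 0 < δ) (ha : 0 ≤ a)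
    {u : Eucl N → ℝ} (hu : Continuous u)
    (hgrowth : ∀ x, |u x| ≤ C * (1 + ‖x‖ ^ 2) ^ (β / 2)) {x : Eucl N}
    (htouch : ∀ z, u (x + z) - u x ≤
      a * ((1 + ‖x + z‖ ^ 2) ^ (β / 2) - (1 + ‖x‖ ^ 2) ^ (β / 2))) :
    -(a * (4 * fracConst N s * ∫ z : Eucl N, levyProfile N s β ‖z‖) *
      (1 + ‖x‖ ^ 2) ^ (β / 2 - s)) ≤ truncFracLaplacian s u x δ := by
  set X : ℝ := 1 + ‖x‖ ^ 2 with hX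
  have hX0 : 0 < X := by positivity
  have hr : 0 < √X := Real.sqrt_pos.2 hX0
  set G : Eucl N → ℝ := {z : Eucl N | δ ≤ ‖z‖}.indicator
      (fun z => (u x - u (x - z)) / ‖z‖ ^ ((N : ℝ) + 2 * s)) with hG
  set P : Eucl N → ℝ :=
    fun z => √X ^ (-((N : ℝ) + 2 * s)) * levyProfile N s β ‖(√X)⁻¹ • z‖ with hP
  set J : ℝ := ∫ z : Eucl N, levyProfile N s β ‖z‖
  have hGi : Integrable G := integrable_truncated_difference hN hs1 hβ0 hβ hC hδ hu hgrowth x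
  have hPi : Integrable P := ((integrable_levyProfile_norm hN hs1 hβ).comp_smul
    (inv_ne_zero hr.ne')).const_mul _
  -- Pairing `z` with `-z` produces second differences. Since `G` and its reflection have equal
  -- integrals, the 8 becomes 4 in the final bound.
  have hpt : ∀ z, -(8 * a * X ^ (β / 2)) * P z ≤ G z + G (-z) := by
    intro z
    have hPz : P z = min ((‖z‖ / √X) ^ 2) ((‖z‖ / √X) ^ β) / ‖z‖ ^ ((N : ℝ) + 2 * s) :=
      levyProfile_scaled hr z
    by_cases hz : δ ≤ ‖z‖
    · have hq : 0 ≤ ‖z‖ ^ ((N : ℝ) + 2 * s) := by positivity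
      rw [hG, indicator_of_mem (by exact hz), indicator_of_mem (by simpa using hz), hPz, norm_neg,
        sub_neg_eq_add, ← add_div, mul_div_assoc']
      gcongr
      have e1 := htouch z
      have e2 := htouch (-z)
      rw [← sub_eq_add_neg] at e2
      have e3 := mul_le_mul_of_nonneg_left
        (bracket_second_difference_le hβ0 (by linarith) x z) ha
      linarith
    · have hPnn : 0 ≤ P z := by rw [hPz]; positivity
      rw [hG, indicator_of_notMem (by exact hz), indicator_of_notMem (by simpa using hz), add_zero]
      have : 0 ≤ 8 * a * X ^ (β / 2) * P z := by positivity
      linarith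
  have hint := integral_mono (hPi.const_mul _) (hGi.add hGi.comp_neg) hpt
  rw [integral_const_mul, integral_add' hGi hGi.comp_neg, integral_neg_eq_self G volume,
    integral_levyProfile_scaled hr] at hint
  have hpow : X ^ (β / 2 - s) = X ^ (β / 2) * √X ^ (-(2 * s)) := by
    rw [Real.sqrt_eq_rpow, ← Real.rpow_mul hX0.le, ← Real.rpow_add hX0]
    congr 1; ring
  have hmul := mul_le_mul_of_nonneg_left hint (fracConst_nonneg N hs0 hs1)
  rw [truncFracLaplacian_eq, hpow]
  linarith

/-! ### The maximum principle. -/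

/-- A function of growth `θ` minus a positive multiple of one of growth `β > θ` attains its
supremum, provided that this supremum is positive. -/
theorem exists_forall_ge_of_growth {N : ℕ} {θ β C ε b : ℝ} (hθβ : θ < β) (hε : 0 < ε) (hb : 0 ≤ b)
    {u : Eucl N → ℝ} (hu : Continuous u)
    (hgrowth : ∀ x, u x ≤ C * (1 + ‖x‖ ^ 2) ^ (θ / 2)) {x₁ : Eucl N}
    (hx₁ : 0 < u x₁ - ε * ((1 + ‖x₁‖ ^ 2) ^ (β / 2) + b)) :
    ∃ x, ∀ y, u y - ε * ((1 + ‖y‖ ^ 2) ^ (β / 2) + b) ≤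
      u x - ε * ((1 + ‖x‖ ^ 2) ^ (β / 2) + b) := by
  have hpos : ∀ x : Eucl N, 0 < 1 + ‖x‖ ^ 2 := fun x => by positivity
  have hcont : Continuous fun x : Eucl N => u x - ε * ((1 + ‖x‖ ^ 2) ^ (β / 2) + b) := by
    refine hu.sub (continuous_const.mul (Continuous.add ?_ continuous_const))
    exact Continuous.rpow_const (by fun_prop) fun x => Or.inl (hpos x).ne'
  refine hcont.exists_forall_ge' x₁ ?_
  have hlim : Tendsto (fun x : Eucl N => (1 + ‖x‖ ^ 2) ^ ((β - θ) / 2)) (cocompact _) atTop := by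
    refine (tendsto_rpow_atTop (by linarith)).comp (tendsto_atTop_add_const_left _ _ ?_)
    exact (tendsto_pow_atTop two_ne_zero).comp tendsto_norm_cocompact_atTop
  -- Once `X ^ ((β - θ) / 2) ≥ C / ε`, the barrier exceeds `u`, so the difference is nonpositive,
  -- hence below its value at `x₁`.
  filter_upwards [hlim.eventually_ge_atTop (C / ε)] with x hx
  refine le_trans ?_ hx₁.le
  have hsplit : (1 + ‖x‖ ^ 2) ^ (β / 2) =
      (1 + ‖x‖ ^ 2) ^ ((β - θ) / 2) * (1 + ‖x‖ ^ 2) ^ (θ / 2) := by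
    rw [← Real.rpow_add (hpos x)]; congr 1; ring
  rw [div_le_iff₀' hε] at hx
  have h1 := mul_le_mul_of_nonneg_right hx (Real.rpow_pos_of_pos (hpos x) (θ / 2)).le
  have h2 := mul_nonneg hε.le hb
  have h3 := hgrowth x
  rw [mul_add, hsplit, ← mul_assoc]
  linarith

theorem IsClassicalSolution.neg {N : ℕ} {s : ℝ} {ρ c u : Eucl N → ℝ}
    (h : IsClassicalSolution s ρ c u) : IsClassicalSolution s ρ c (-u) where
  contDiff := h.contDiff.neg
  memLs := by
    have := Integrable.neg h.memLs
    refine this.congr (ae_of_all _ fun x => ?_)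
    simp [neg_div]
  equation x := by
    obtain ⟨l, hl, he⟩ := h.equation x
    refine ⟨-l, ?_, ?_⟩
    · refine (Tendsto.neg hl).congr fun ε => ?_
      rw [truncFracLaplacian, truncFracLaplacian, ← mul_neg, ← integral_neg]
      congr 2 with y
      simp only [Pi.neg_apply]; ring
    · rw [InnerProductSpace.laplacian_neg]
      simp only [Pi.neg_apply]
      linarith

/-- Maximum principle at infinity: classical solutions of growth less than `2 s - α` are
nonpositive. -/
theorem IsClassicalSolution.nonpos {N : ℕ} (hN : 1 ≤ N) {s α C₀ c₀ : ℝ} (hs0 : 0 < s)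
    (hs1 : s < 1) (hc₀ : 0 < c₀) {ρ c : Eucl N → ℝ} (hρ : HypRho α C₀ ρ) (hc : ∀ x, c₀ ≤ c x)
    {u : Eucl N → ℝ} (hu : IsClassicalSolution s ρ c u) {C θ : ℝ} (hC : 0 ≤ C) (hθ0 : 0 ≤ θ)
    (hθ : θ < 2 * s - α) (hgrowth : ∀ x, |u x| ≤ C * (1 + ‖x‖ ^ 2) ^ (θ / 2)) (x₁ : Eucl N) :
    u x₁ ≤ 0 := by
  obtain ⟨β, hθβ, hβα⟩ := exists_between hθ
  have hα := hρ.alpha_nonneg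
  have hC₀ := hρ.const_pos
  have hβ0 : 0 ≤ β := by linarith
  have hβ : β < 2 * s := by linarith
  set A : ℝ := 4 * fracConst N s * ∫ z : Eucl N, levyProfile N s β ‖z‖ with hA
  have hA0 : 0 ≤ A := mul_nonneg (mul_nonneg (by norm_num) (fracConst_nonneg N hs0 hs1))
    (integral_nonneg fun z => levyProfile_nonneg (norm_nonneg z))
  set K : ℝ := N * β + A with hK
  have hK0 : 0 ≤ K := by positivity
  set b : ℝ := K / (C₀ * c₀) with hb
  have hb0 : 0 ≤ b := by positivity
  have hgrowth' : ∀ x, |u x| ≤ C * (1 + ‖x‖ ^ 2) ^ (β / 2) := fun x =>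
    (hgrowth x).trans (mul_le_mul_of_nonneg_left (Real.rpow_le_rpow_of_exponent_le
      (by linarith [sq_nonneg ‖x‖]) (by linarith)) hC)
  have key : ∀ ε > 0, u x₁ ≤ ε * ((1 + ‖x₁‖ ^ 2) ^ (β / 2) + b) := by
    intro ε hε
    by_contra! hlt
    obtain ⟨x, hx⟩ := exists_forall_ge_of_growth hθβ hε hb0 hu.contDiff.continuous
      (fun y => (le_abs_self _).trans (hgrowth y)) (sub_pos.2 hlt)
    have hpos := (sub_pos.2 hlt).trans_le (hx x₁)
    -- The constant `b` cancels in differences; it only serves to force `u x > ε * b`.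
    have htouch : ∀ z, u (x + z) - u x ≤
        ε * ((1 + ‖x + z‖ ^ 2) ^ (β / 2) - (1 + ‖x‖ ^ 2) ^ (β / 2)) := fun z => by
      have := hx (x + z); linarith
    obtain ⟨l, hl, heq⟩ := hu.equation x
    have hfrac : -(ε * A * (1 + ‖x‖ ^ 2) ^ (β / 2 - s)) ≤ l := by
      refine ge_of_tendsto hl (eventually_nhdsWithin_of_forall fun δ hδ => ?_)
      exact neg_le_truncFracLaplacian hN hs0 hs1 hβ0 hβ hC hδ hε.le hu.contDiff.continuous
        hgrowth' htouch
    have hlap := laplacian_le_of_touching hu.contDiff (x := x)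
      (a := ε * (β / 2 * (1 + ‖x‖ ^ 2) ^ (β / 2 - 1))) fun z => by
        refine (htouch z).trans ?_
        rw [mul_assoc]
        exact mul_le_mul_of_nonneg_left (bracket_sub_le hβ0 (by linarith) x z) hε.le
    have hX1 : 1 ≤ 1 + ‖x‖ ^ 2 := by linarith [sq_nonneg ‖x‖]
    set X : ℝ := 1 + ‖x‖ ^ 2 with hX
    -- Both exponent comparisons come from `β + α < 2 s < 2`.
    have hpow1 : X ^ (β / 2 - 1) ≤ X ^ (-α / 2) :=
      Real.rpow_le_rpow_of_exponent_le hX1 (by linarith)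
    have hpow2 : X ^ (β / 2 - s) ≤ X ^ (-α / 2) :=
      Real.rpow_le_rpow_of_exponent_le hX1 (by linarith)
    have hXα : 0 < X ^ (-α / 2) := Real.rpow_pos_of_pos (by linarith) _
    have hXβ : 0 < X ^ (β / 2) := Real.rpow_pos_of_pos (by linarith) _
    have hupper : ρ x * c x * u x ≤ ε * (K * X ^ (-α / 2)) := by
      have e1 : 2 * N * (ε * (β / 2 * X ^ (β / 2 - 1))) ≤ ε * (N * β * X ^ (-α / 2)) := by
        calc 2 * N * (ε * (β / 2 * X ^ (β / 2 - 1))) = ε * (N * β * X ^ (β / 2 - 1)) := by ring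
          _ ≤ _ := by gcongr
      have e2 : ε * A * X ^ (β / 2 - s) ≤ ε * (A * X ^ (-α / 2)) := by
        rw [mul_assoc]; gcongr
      have e3 : ε * (K * X ^ (-α / 2)) =
          ε * (N * β * X ^ (-α / 2)) + ε * (A * X ^ (-α / 2)) := by rw [hK]; ring
      linarith
    have hρc : C₀ * X ^ (-α / 2) * c₀ ≤ ρ x * c x :=
      mul_le_mul (hρ.lower_bound x) (hc x) hc₀.le
        ((by positivity : 0 ≤ C₀ * X ^ (-α / 2)).trans (hρ.lower_bound x))
    have hlower : C₀ * X ^ (-α / 2) * c₀ * (ε * b) < ρ x * c x * u x := by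
      have hub : ε * b < u x := by
        have : 0 < ε * X ^ (β / 2) := by positivity
        linarith
      exact mul_lt_mul' hρc hub (by positivity)
        ((by positivity : 0 < C₀ * X ^ (-α / 2) * c₀).trans_le hρc)
    have hbK : C₀ * X ^ (-α / 2) * c₀ * (ε * b) = ε * (K * X ^ (-α / 2)) := by
      rw [hb]; field_simp
    linarith
  have hlim : Tendsto (fun ε : ℝ => ε * ((1 + ‖x₁‖ ^ 2) ^ (β / 2) + b)) (𝓝[>] 0) (𝓝 0) := by
    have : Tendsto (fun ε : ℝ => ε * ((1 + ‖x₁‖ ^ 2) ^ (β / 2) + b)) (𝓝 0)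
        (𝓝 (0 * ((1 + ‖x₁‖ ^ 2) ^ (β / 2) + b))) := tendsto_id.mul_const _
    rw [zero_mul] at this
    exact this.mono_left nhdsWithin_le_nhds
  exact ge_of_tendsto hlim (eventually_nhdsWithin_of_forall key)

end MixedElliptic

theorem corollary2p8 (N : ℕ) (hN : 1 ≤ N) (s : ℝ) (hs0 : 0 < s) (hs1 : s < 1)
    (α C₀ : ℝ) (hα : 0 ≤ α) (hαs : α < 2 * s) (hC₀ : 0 < C₀) :
    ∃ K : ℝ, ∀ p c₀ : ℝ, 1 ≤ p → 0 < c₀ → K ≤ p * c₀ →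
      ∀ ρ c : MixedElliptic.Eucl N → ℝ,
        MixedElliptic.HypRho α C₀ ρ → MixedElliptic.HypC c → (∀ x, c₀ ≤ c x) →
        ∀ u : MixedElliptic.Eucl N → ℝ, MixedElliptic.IsClassicalSolution s ρ c u →
          ∀ C θ : ℝ, 0 < C → 0 ≤ θ → θ < 2 * s - α →
            (∀ x, |u x| ≤ C * (1 + ‖x‖ ^ 2) ^ (θ / 2)) →
            ∀ x, u x = 0 := by
  -- The maximum principle needs no lower bound on `p * c₀`, so any constant will do.
  refine ⟨0, fun p c₀ _ hc₀ _ ρ c hρ _ hc u hu C θ hC hθ0 hθ hgrowth x => ?_⟩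
  refine le_antisymm (hu.nonpos hN hs0 hs1 hc₀ hρ hc hC.le hθ0 hθ hgrowth x) ?_
  have := hu.neg.nonpos hN hs0 hs1 hc₀ hρ hc hC.le hθ0 hθ (by simpa using hgrowth) x
  simpa using this
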